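/- Let $p$ be a prime and let $v_p$ denote the $p$-adic valuation on $\mathbb{Z}$, with $v_p(0)=\infty$. Let $f,g\in\mathbb{Z}[x]$ be monic polynomials with resultant $r$, and let $s\ge 0$ be an integer such that $v_p(f(n))\ge s$ and $v_p(g(n))\ge s$ for every $n\in\mathbb{Z}$. Put $$S=\max_{n\in\mathbb{Z}}\min\{v_p(f(n)),v_p(g(n))\}.$$ If this maximum exists and is finite (which is always the case when $r\neq 0$), then $$v_p(r)\;\ge\; S-s+p\,s^2\,\frac{p-1}{p-p^{\,1-\lfloor \log_p((p-1)s+1)\rfloor}},$$ where for $s=0$ (when the denominator vanishes) the last summand is read as $0$. -/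

import Mathlib

/-- The `p`-adic valuation of an integer, with values in `ℕ ∪ {∞}`, so that `v_p(0) = ∞`
(for prime `p`). -/
noncomputable def intVal (p : ℕ) (n : ℤ) : ℕ∞ := emultiplicity (p : ℤ) n

/-- The set of all values `min (v_p(f(n))) (v_p(g(n)))`, for `n` an integer. -/
def minValSet (p : ℕ) (f g : Polynomial ℤ) : Set ℕ∞ :=
  Set.range fun n : ℤ => min (intVal p (f.eval n)) (intVal p (g.eval n))

/-! Over the algebraic closure of `ℚ_[p]`, write `f = ∏ (x - α i)` and `g = ∏ (x - β j)`. Then `r =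
∏ (α i - β j)`, so `v_p(r)` is a sum of depths of differences. These are estimated along the tree of
residue classes `n + p ^ k ℤ`. A point belongs to such a class when its depth at `n` exceeds `k -
1`; its mass there is the part of that depth in `(k - 1, k]`. Depths may be fractional.

In a class, let `A`, `B` be the masses of the two families and `u`, `w` lower bounds for their
potentials. Each of the `p` child classes inherits the bounds `u - A`, `w - B`
(`pot_sub_mass_le_pot_child`), and the energy is at least `A * B` plus the energies of the children
(`mass_mul_mass_add_le_energy`). If the children satisfy a bound with constant `c`, the total is at
least `A * B + p * c * (u - A) * (w - B)`. With `c' = p * c / (1 + p * c)`, this exceeds `c' * u *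
w` by a positive multiple of `(A - c' * u) * (B - c' * w)`. Both factors are nonnegative by
`ratio_mul_le_mass`; iterating gives `ratio`.

The summand `S - s` comes from an integer `n` attaining `S`: its surplus depth is carried down the
classes containing `n` until one mass exhausts its bound, where the point nearest to `n` converts it
into energy (`ratio_mul_add_le_energy`).

Truncation at `M` keeps depths finite when `f` or `g` has an integer root. -/

/-- A real-valued ultrametric depth function on a ring, which on the integers agrees with the
`p`-adic valuation truncated at `M`. -/
structure IsTruncatedDepth {K : Type*} [Ring K] (p M : ℕ) (v : K → ℝ) : Prop where
  neg : ∀ a, v (-a) = v a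
  add : ∀ a b, min (v a) (v b) ≤ v (a + b)
  le_of_dvd : ∀ (k : ℕ) (n : ℤ), k ≤ M → (p : ℤ) ^ k ∣ n → (k : ℝ) ≤ v (n : K)
  le_of_not_dvd : ∀ (k : ℕ) (n : ℤ), ¬ (p : ℤ) ^ (k + 1) ∣ n → v (n : K) ≤ k

/-! ### Residue classes, masses, potentials and energies -/

namespace RootTree

variable {K : Type*} [Ring K] {ι κ : Type*}

/-- The contribution above level `k` of the points `α i`, `i ∈ I`, to the depth at `x`. -/
noncomputable def pot (v : K → ℝ) (α : ι → K) (I : Finset ι) (k : ℕ) (x : ℤ) : ℝ :=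
  ∑ i ∈ I, (v ((x : K) - α i) + 1 - k)

/-- The contribution of the single level `k` to the depth at `n`. -/
noncomputable def mass (v : K → ℝ) (α : ι → K) (I : Finset ι) (k : ℕ) (n : ℤ) : ℝ :=
  ∑ i ∈ I, min 1 (v ((n : K) - α i) + 1 - k)

/-- The contribution above level `k` to the depth of a resultant. -/
noncomputable def energy (v : K → ℝ) (α : ι → K) (β : κ → K) (I : Finset ι) (J : Finset κ)
    (k : ℕ) : ℝ :=
  ∑ i ∈ I, ∑ j ∈ J, (v (α i - β j) + 1 - k)

/-- The indices of the points that lie in the `j`-th residue class inside `n + p ^ k ℤ`. -/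
noncomputable def child (p : ℕ) (v : K → ℝ) (α : ι → K) (I : Finset ι) (k : ℕ) (n : ℤ) (j : ℕ) :
    Finset ι :=
  I.filter fun i => (k : ℝ) < v (((n + (p : ℤ) ^ k * j : ℤ) : K) - α i)

variable {p M : ℕ} {v : K → ℝ}

theorem _root_.IsTruncatedDepth.sub_comm (hv : IsTruncatedDepth p M v) (a b : K) :
    v (a - b) = v (b - a) := by
  rw [← hv.neg, neg_sub]

theorem _root_.IsTruncatedDepth.triangle (hv : IsTruncatedDepth p M v) (a b c : K) :
    min (v (a - b)) (v (b - c)) ≤ v (a - c) := by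
  have := hv.add (a - b) (b - c)
  rwa [sub_add_sub_cancel] at this

theorem _root_.IsTruncatedDepth.le_sub_of_dvd (hv : IsTruncatedDepth p M v) {k : ℕ} (hk : k ≤ M)
    {m n : ℤ} (h : (p : ℤ) ^ k ∣ m - n) : (k : ℝ) ≤ v ((m : K) - n) := by
  have := hv.le_of_dvd k (m - n) hk h
  rwa [Int.cast_sub] at this

theorem one_le_of_mem_child (hv : IsTruncatedDepth p M v) {α : ι → K} {I : Finset ι} {k : ℕ}
    {n : ℤ} {j : ℕ} {i : ι} (hk : k ≤ M) (hi : i ∈ child p v α I k n j) :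
    (1 : ℝ) ≤ v ((n : K) - α i) + 1 - k := by
  have h1 := (Finset.mem_filter.1 hi).2
  have h2 := hv.triangle (n : K) ((n + (p : ℤ) ^ k * j : ℤ) : K) (α i)
  have h3 : (k : ℝ) ≤ v ((n : K) - ((n + (p : ℤ) ^ k * j : ℤ) : K)) :=
    hv.le_sub_of_dvd hk (by simp)
  have := (le_min h3 h1.le).trans h2
  linarith

theorem child_index_unique (hv : IsTruncatedDepth p M v) (hp : p ≠ 0) {α : ι → K} {I : Finset ι}
    {k : ℕ} {n : ℤ} {j j' : ℕ} {i : ι} (hj : j < p) (hj' : j' < p)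
    (hi : i ∈ child p v α I k n j) (hi' : i ∈ child p v α I k n j') : j = j' := by
  by_contra hne
  have h1 := (Finset.mem_filter.1 hi).2
  have h2 := (Finset.mem_filter.1 hi').2
  rw [hv.sub_comm] at h2
  have h3 := (lt_min h1 h2).trans_le (hv.triangle _ _ _)
  rw [← Int.cast_sub] at h3
  refine absurd (hv.le_of_not_dvd k _ ?_) (not_le.2 h3)
  have : (n + (p : ℤ) ^ k * j) - (n + (p : ℤ) ^ k * j') = (p : ℤ) ^ k * (j - j') := by ring
  rw [this, pow_succ, mul_dvd_mul_iff_left (by positivity)]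
  intro hd
  have := Int.eq_zero_of_abs_lt_dvd hd (by rw [abs_lt]; constructor <;> omega)
  omega

theorem sum_ite_of_subsingleton {s : Finset ℕ} {P : ℕ → Prop} [DecidablePred P] (c : ℝ)
    (h : ∀ j ∈ s, ∀ j' ∈ s, P j → P j' → j = j') :
    (∑ j ∈ s, if P j then c else 0) = if ∃ j ∈ s, P j then c else 0 := by
  split_ifs with hex
  · obtain ⟨j, hj, hPj⟩ := hex
    rw [Finset.sum_eq_single_of_mem j hj, if_pos hPj]
    intro b hb hbj
    rw [if_neg fun hPb => hbj (h b hb j hj hPb hPj)]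
  · push Not at hex
    exact Finset.sum_eq_zero fun j hj => if_neg (hex j hj)

theorem mass_le_card (α : ι → K) (I : Finset ι) (k : ℕ) (n : ℤ) :
    mass v α I k n ≤ I.card := by
  simpa [mass] using Finset.sum_le_card_nsmul I _ 1 fun i _ => min_le_left (1 : ℝ) _

theorem mass_nonneg {α : ι → K} {I : Finset ι} {k : ℕ} {n : ℤ}
    (hI : ∀ i ∈ I, (k : ℝ) < v ((n : K) - α i) + 1) : 0 ≤ mass v α I k n :=
  Finset.sum_nonneg fun i hi => le_min zero_le_one (by linarith [hI i hi])

/-- A point lies in at most one child class, and if it lies in one then its depth at `n` is at least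
`k`, so it has full mass 1. -/
theorem sum_card_child_le_mass (hv : IsTruncatedDepth p M v) (hp : p ≠ 0) {α : ι → K}
    {I : Finset ι} {k : ℕ} {n : ℤ} (hk : k ≤ M)
    (hI : ∀ i ∈ I, (k : ℝ) < v ((n : K) - α i) + 1) :
    ∑ j ∈ Finset.range p, ((child p v α I k n j).card : ℝ) ≤ mass v α I k n := by
  classical
  have h1 : ∀ j, ((child p v α I k n j).card : ℝ)
      = ∑ i ∈ I, if i ∈ child p v α I k n j then (1 : ℝ) else 0 := by
    intro j
    rw [← Finset.sum_filter, Finset.sum_const, nsmul_one]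
    congr 2
    ext i
    simp [child]
  simp_rw [h1]
  rw [Finset.sum_comm]
  refine Finset.sum_le_sum fun i hi => ?_
  rw [sum_ite_of_subsingleton 1 fun j hj j' hj' h h' => child_index_unique hv hp
    (Finset.mem_range.1 hj) (Finset.mem_range.1 hj') h h']
  split_ifs with hex
  · obtain ⟨j, -, hj⟩ := hex
    exact le_min le_rfl (one_le_of_mem_child hv hk hj)
  · exact le_min zero_le_one (by linarith [hI i hi])

theorem lt_of_mem_child {α : ι → K} {I : Finset ι} {k : ℕ} {n : ℤ} {j : ℕ} :
    ∀ i ∈ child p v α I k n j,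
      ((k + 1 : ℕ) : ℝ) < v (((n + (p : ℤ) ^ k * j : ℤ) : K) - α i) + 1 := by
  intro i hi
  have := (Finset.mem_filter.1 hi).2
  push_cast at this ⊢
  linarith

/-- A point of the child loses exactly 1. Any other point has depth at most `k` at `x`, hence no
more than its depth at `n`, and its mass absorbs its whole contribution. -/
theorem pot_sub_mass_le_pot_child (hv : IsTruncatedDepth p M v) (α : ι → K) (I : Finset ι)
    {k : ℕ} (n : ℤ) (hk : k + 1 ≤ M) (j : ℕ) (y : ℤ) :
    pot v α I k (n + (p : ℤ) ^ k * j + (p : ℤ) ^ (k + 1) * y) - mass v α I k n ≤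
      pot v α (child p v α I k n j) (k + 1) (n + (p : ℤ) ^ k * j + (p : ℤ) ^ (k + 1) * y) := by
  unfold pot mass
  rw [← Finset.sum_sub_distrib, child, Finset.sum_filter]
  refine Finset.sum_le_sum fun i hi => ?_
  set m : ℤ := n + (p : ℤ) ^ k * j with hm
  set x : ℤ := m + (p : ℤ) ^ (k + 1) * y with hx
  have hmx : ((k + 1 : ℕ) : ℝ) ≤ v ((m : K) - (x : K)) := hv.le_sub_of_dvd hk (by simp [hx])
  have hnx : (k : ℝ) ≤ v ((n : K) - (x : K)) := by
    refine hv.le_sub_of_dvd (by omega) ?_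
    rw [hx, hm]
    exact ⟨-(j + p * y), by ring⟩
  have h1 := hv.triangle (m : K) x (α i)
  have h2 := hv.triangle (n : K) x (α i)
  push_cast at hmx ⊢
  split_ifs with h
  · have h3 := one_le_of_mem_child hv (by omega : k ≤ M)
      (Finset.mem_filter.2 ⟨hi, h⟩ : i ∈ child p v α I k n j)
    rw [min_eq_left h3]
    linarith
  · have h3 : v ((x : K) - α i) ≤ k := by
      by_contra! h4
      exact h ((lt_min (by linarith) h4).trans_le h1)
    have h4 : v ((x : K) - α i) ≤ v ((n : K) - α i) := (le_min (h3.trans hnx) le_rfl).trans h2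
    have h5 : v ((x : K) - α i) + 1 - k ≤ min 1 (v ((n : K) - α i) + 1 - k) :=
      le_min (by linarith) (by linarith)
    linarith

/-- For a pair in a common child both masses are 1 and the terms balance. For any other pair the
ultrametric inequality bounds the energy below by the smaller excess, and a product of masses in
`[0, 1]` is no larger. -/
theorem mass_mul_mass_add_le_energy (hv : IsTruncatedDepth p M v) (hp : p ≠ 0) {α : ι → K}
    {β : κ → K} {I : Finset ι} {J : Finset κ} {k : ℕ} {n : ℤ} (hk : k ≤ M)
    (hI : ∀ i ∈ I, (k : ℝ) < v ((n : K) - α i) + 1)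
    (hJ : ∀ i ∈ J, (k : ℝ) < v ((n : K) - β i) + 1) :
    mass v α I k n * mass v β J k n + ∑ j ∈ Finset.range p,
      energy v α β (child p v α I k n j) (child p v β J k n j) (k + 1) ≤ energy v α β I J k := by
  classical
  have h1 : ∀ j, energy v α β (child p v α I k n j) (child p v β J k n j) (k + 1) =
      ∑ i ∈ I, ∑ i' ∈ J, if i ∈ child p v α I k n j ∧ i' ∈ child p v β J k n j then
        (v (α i - β i') + 1 - (k + 1 : ℕ)) else 0 := by
    intro j
    unfold energy child
    rw [Finset.sum_filter]
    refine Finset.sum_congr rfl fun i hi => ?_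
    rw [Finset.sum_filter]
    simp only [Finset.mem_filter, hi, true_and]
    split_ifs with h
    · refine Finset.sum_congr rfl fun i' hi' => ?_
      simp only [h, hi', true_and]
    · simp only [h, false_and, if_false, Finset.sum_const_zero]
  simp_rw [h1]
  rw [Finset.sum_comm]
  simp_rw [Finset.sum_comm (s := Finset.range p)]
  unfold mass energy
  rw [Finset.sum_mul_sum, ← Finset.sum_add_distrib]
  refine Finset.sum_le_sum fun i hi => ?_
  rw [← Finset.sum_add_distrib]
  refine Finset.sum_le_sum fun i' hi' => ?_
  rw [sum_ite_of_subsingleton _ fun j hj j' hj' h h' => child_index_unique hv hp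
    (Finset.mem_range.1 hj) (Finset.mem_range.1 hj') h.1 h'.1]
  split_ifs with hex
  · obtain ⟨j, -, hj, hj'⟩ := hex
    rw [min_eq_left (one_le_of_mem_child hv hk hj), min_eq_left (one_le_of_mem_child hv hk hj')]
    push_cast
    linarith
  · have h2 := hv.triangle (α i) (n : K) (β i')
    rw [hv.sub_comm (α i)] at h2
    have hx := hI i hi
    have hy := hJ i' hi'
    set x := v ((n : K) - α i)
    set y := v ((n : K) - β i')
    have hx0 : 0 ≤ min 1 (x + 1 - k) := le_min zero_le_one (by linarith)
    have hy0 : 0 ≤ min 1 (y + 1 - k) := le_min zero_le_one (by linarith)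
    rw [add_zero]
    rcases le_total x y with hxy | hxy
    · rw [min_eq_left hxy] at h2
      have := mul_le_mul_of_nonneg_left (min_le_left 1 (y + 1 - k)) hx0
      linarith [min_le_right 1 (x + 1 - k)]
    · rw [min_eq_right hxy] at h2
      have := mul_le_mul_of_nonneg_right (min_le_left 1 (x + 1 - k)) hy0
      linarith [min_le_right 1 (y + 1 - k)]

/-! ### Energy forced by the point nearest to an integer -/

/-- Following a single point `n`: the set with the deeper point forces the full depth of the
other set to appear in the energy. -/
theorem pot_le_energy_of_dominates (hv : IsTruncatedDepth p M v) {α : ι → K} {β : κ → K}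
    {I : Finset ι} {J : Finset κ} {k : ℕ} {n : ℤ}
    (hI : ∀ i ∈ I, (k : ℝ) < v ((n : K) - α i) + 1)
    (hJ : ∀ i ∈ J, (k : ℝ) < v ((n : K) - β i) + 1)
    {i₀ : ι} (hi₀ : i₀ ∈ I) (hdom : ∀ j ∈ J, v ((n : K) - β j) ≤ v ((n : K) - α i₀)) :
    pot v β J k n ≤ energy v α β I J k ∧
      mass v α I k n * mass v β J k n + pot v β J k n - mass v β J k n ≤ energy v α β I J k := by
  classical
  have key : ∀ i ∈ I, ∀ j ∈ J,
      min (v ((n : K) - α i)) (v ((n : K) - β j)) ≤ v (α i - β j) := by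
    intro i _ j _
    have h2 := hv.triangle (α i) (n : K) (β j)
    rwa [hv.sub_comm (α i)] at h2
  have hpos : ∀ i ∈ I, ∀ j ∈ J, 0 ≤ v (α i - β j) + 1 - k := by
    intro i hi j hj
    have := (lt_min (sub_lt_iff_lt_add.2 (hI i hi)) (sub_lt_iff_lt_add.2 (hJ j hj))).trans_le
      (key i hi j hj)
    linarith
  have hrow : ∀ j ∈ J, v ((n : K) - β j) ≤ v (α i₀ - β j) := fun j hj =>
    (le_min (hdom j hj) le_rfl).trans (key i₀ hi₀ j hj)
  constructor
  · unfold pot energy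
    refine (Finset.sum_le_sum fun j hj => ?_).trans (Finset.single_le_sum
      (f := fun i => ∑ j ∈ J, (v (α i - β j) + 1 - k))
      (fun i hi => Finset.sum_nonneg (hpos i hi)) hi₀)
    linarith [hrow j hj]
  · have h1 : mass v α I k n * mass v β J k n + pot v β J k n - mass v β J k n =
        ∑ i ∈ I, ∑ j ∈ J, (min 1 (v ((n : K) - α i) + 1 - k) * min 1 (v ((n : K) - β j) + 1 - k)
          + if i = i₀ then v ((n : K) - β j) + 1 - k - min 1 (v ((n : K) - β j) + 1 - k)
            else 0) := by
      simp_rw [Finset.sum_add_distrib]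
      rw [Finset.sum_comm (f := fun i j => if i = i₀ then _ else _)]
      simp only [Finset.sum_ite_eq', hi₀, if_true]
      rw [← Finset.sum_mul_sum, Finset.sum_sub_distrib]
      unfold mass pot
      ring
    rw [h1]
    unfold energy
    refine Finset.sum_le_sum fun i hi => Finset.sum_le_sum fun j hj => ?_
    have hx := hI i hi
    have hy := hJ j hj
    have hk := key i hi j hj
    split_ifs with h
    · subst h
      have hr := hrow j hj
      set x := v ((n : K) - α i)
      set y := v ((n : K) - β j)
      have hy0 : 0 ≤ min 1 (y + 1 - k) := le_min zero_le_one (by linarith)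
      have := mul_le_mul_of_nonneg_right (min_le_left 1 (x + 1 - k)) hy0
      linarith
    · set x := v ((n : K) - α i)
      set y := v ((n : K) - β j)
      have hx0 : 0 ≤ min 1 (x + 1 - k) := le_min zero_le_one (by linarith)
      have hy0 : 0 ≤ min 1 (y + 1 - k) := le_min zero_le_one (by linarith)
      rcases le_total x y with hxy | hxy
      · rw [min_eq_left hxy] at hk
        have := mul_le_mul_of_nonneg_left (min_le_left 1 (y + 1 - k)) hx0
        linarith [min_le_right 1 (x + 1 - k)]
      · rw [min_eq_right hxy] at hk
        have := mul_le_mul_of_nonneg_right (min_le_left 1 (x + 1 - k)) hy0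
        linarith [min_le_right 1 (y + 1 - k)]

theorem energy_comm (hv : IsTruncatedDepth p M v) (α : ι → K) (β : κ → K) (I : Finset ι)
    (J : Finset κ) (k : ℕ) : energy v α β I J k = energy v β α J I k := by
  unfold energy
  rw [Finset.sum_comm]
  simp_rw [hv.sub_comm (α _)]

theorem pot_le_energy_or (hv : IsTruncatedDepth p M v) {α : ι → K} {β : κ → K}
    {I : Finset ι} {J : Finset κ} {k : ℕ} {n : ℤ}
    (hI : ∀ i ∈ I, (k : ℝ) < v ((n : K) - α i) + 1)
    (hJ : ∀ i ∈ J, (k : ℝ) < v ((n : K) - β i) + 1) :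
    (pot v β J k n ≤ energy v α β I J k ∧
      mass v α I k n * mass v β J k n + pot v β J k n - mass v β J k n ≤ energy v α β I J k) ∨
    (pot v α I k n ≤ energy v α β I J k ∧
      mass v β J k n * mass v α I k n + pot v α I k n - mass v α I k n ≤ energy v α β I J k) := by
  rcases I.eq_empty_or_nonempty with rfl | hIne
  · right; simp [pot, mass, energy]
  rcases J.eq_empty_or_nonempty with rfl | hJne
  · left; simp [pot, mass, energy]
  obtain ⟨i₀, hi₀, hi⟩ := I.exists_max_image (fun i => v ((n : K) - α i)) hIne
  obtain ⟨j₀, hj₀, hj⟩ := J.exists_max_image (fun i => v ((n : K) - β i)) hJne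
  rcases le_total (v ((n : K) - β j₀)) (v ((n : K) - α i₀)) with h | h
  · exact Or.inl (pot_le_energy_of_dominates hv hI hJ hi₀ fun j hj' => (hj j hj').trans h)
  · rw [energy_comm hv]
    exact Or.inr (pot_le_energy_of_dominates hv hJ hI hj₀ fun i hi' => (hi i hi').trans h)

/-! ### Lower bounds for masses, and the recursive constant -/

/-- The optimal ratio between energy and the product of potentials in a tree with `l + 1` levels. -/
noncomputable def ratio (p : ℕ) : ℕ → ℝ
  | 0 => 1
  | l + 1 => p * ratio p l / (1 + p * ratio p l)

/-- The sum `p + p ^ 2 + ⋯ + p ^ l`. -/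
noncomputable def geom (p : ℕ) (l : ℕ) : ℝ := ∑ i ∈ Finset.range l, (p : ℝ) ^ (i + 1)

theorem ratio_nonneg (p l : ℕ) : 0 ≤ ratio p l := by
  induction l with
  | zero => exact zero_le_one
  | succ l ih => rw [ratio]; positivity

theorem ratio_le_one (p l : ℕ) : ratio p l ≤ 1 := by
  cases l with
  | zero => exact le_rfl
  | succ l =>
    have := ratio_nonneg p l
    rw [ratio]
    exact div_le_one_of_le₀ (by linarith) (by positivity)

theorem ratio_succ_mul (p l : ℕ) : ratio p (l + 1) * (1 + p * ratio p l) = p * ratio p l := by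
  have := ratio_nonneg p l
  rw [ratio]
  field_simp

/-- A mass that is too small leaves every child a large potential, hence by induction at least `p ^
l` points (for `l = 0`, at least one). Summing over the `p` children contradicts the smallness. -/
theorem min_le_mass (hv : IsTruncatedDepth p M v) (hp : p ≠ 0) (l : ℕ) {α : ι → K}
    {I : Finset ι} {k : ℕ} {n : ℤ} (hk : k + l + 1 ≤ M)
    (hI : ∀ i ∈ I, (k : ℝ) < v ((n : K) - α i) + 1) {u : ℝ}
    (hu : ∀ y : ℤ, u ≤ pot v α I k (n + (p : ℤ) ^ k * y)) :
    min (u - geom p l) ((p : ℝ) ^ (l + 1)) ≤ mass v α I k n := by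
  induction l generalizing I k n u with
  | zero =>
    by_contra! h
    obtain ⟨h1, h2⟩ := lt_min_iff.1 h
    rw [geom, Finset.sum_range_zero, sub_zero] at h1
    rw [zero_add, pow_one] at h2
    refine h2.not_ge (le_trans ?_ (sum_card_child_le_mass hv hp (by omega) hI))
    have h3 : ∀ j ∈ Finset.range p, (1 : ℝ) ≤ (child p v α I k n j).card := by
      intro j _
      rw [Nat.one_le_cast, Nat.one_le_iff_ne_zero]
      intro h0
      -- An empty child has potential 0, contrary to the inherited bound `u - mass > 0`.
      have h4 := pot_sub_mass_le_pot_child hv α I n (by omega : k + 1 ≤ M) j 0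
      rw [Finset.card_eq_zero.1 h0, mul_zero, add_zero, pot, pot, Finset.sum_empty] at h4
      have := hu j
      rw [pot] at this
      linarith
    simpa using Finset.card_nsmul_le_sum _ _ _ h3
  | succ l ih =>
    by_contra! h
    obtain ⟨h1, h2⟩ := lt_min_iff.1 h
    refine h2.not_ge (le_trans ?_ (sum_card_child_le_mass hv hp (by omega) hI))
    have h3 : ∀ j ∈ Finset.range p, (p : ℝ) ^ (l + 1) ≤ (child p v α I k n j).card := by
      intro j _
      have h4 := ih (I := child p v α I k n j) (k := k + 1) (n := n + (p : ℤ) ^ k * j)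
        (u := u - mass v α I k n) (by omega) lt_of_mem_child fun y =>
          le_trans (by
            have := hu (j + p * y)
            rw [show n + (p : ℤ) ^ k * (j + p * y)
              = n + (p : ℤ) ^ k * j + (p : ℤ) ^ (k + 1) * y by ring] at this
            linarith) (pot_sub_mass_le_pot_child hv α I n (by omega) j y)
      refine le_trans (le_min ?_ le_rfl) (h4.trans (mass_le_card _ _ _ _))
      rw [geom, Finset.sum_range_succ] at h1
      rw [geom]
      linarith
    have := Finset.card_nsmul_le_sum _ _ _ h3
    rwa [Finset.card_range, nsmul_eq_mul, ← pow_succ'] at this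

theorem sub_geom_le_mass (hv : IsTruncatedDepth p M v) (hp : p ≠ 0) {l : ℕ} {α : ι → K}
    {I : Finset ι} {k : ℕ} {n : ℤ} (hk : k + l + 1 ≤ M)
    (hI : ∀ i ∈ I, (k : ℝ) < v ((n : K) - α i) + 1) {u : ℝ}
    (hu : ∀ y : ℤ, u ≤ pot v α I k (n + (p : ℤ) ^ k * y)) (hul : u ≤ geom p (l + 1)) :
    u - geom p l ≤ mass v α I k n := by
  refine le_trans (le_min le_rfl ?_) (min_le_mass hv hp l hk hI hu)
  rw [geom, Finset.sum_range_succ] at hul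
  rw [geom]
  linarith

theorem sub_mass_le_pot_child (hv : IsTruncatedDepth p M v) {α : ι → K} {I : Finset ι}
    {k : ℕ} {n : ℤ} (hk : k + 1 ≤ M) {u : ℝ}
    (hu : ∀ y : ℤ, u ≤ pot v α I k (n + (p : ℤ) ^ k * y)) (j : ℕ) (y : ℤ) :
    u - mass v α I k n ≤ pot v α (child p v α I k n j) (k + 1)
      (n + (p : ℤ) ^ k * j + (p : ℤ) ^ (k + 1) * y) := by
  refine le_trans ?_ (pot_sub_mass_le_pot_child hv α I n hk j y)
  have := hu (j + p * y)
  rw [show n + (p : ℤ) ^ k * (j + p * y)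
    = n + (p : ℤ) ^ k * j + (p : ℤ) ^ (k + 1) * y by ring] at this
  linarith

/-- With `A` the mass, each child has at least `ratio p l * (u - A)` points, so `A ≥ p * ratio p l *
(u - A)`; solve for `A`. The cap `geom` passes to the children by `sub_geom_le_mass`. -/
theorem ratio_mul_le_mass (hv : IsTruncatedDepth p M v) (hp : p ≠ 0) (l : ℕ) {α : ι → K}
    {I : Finset ι} {k : ℕ} {n : ℤ} (hk : k + l + 1 ≤ M)
    (hI : ∀ i ∈ I, (k : ℝ) < v ((n : K) - α i) + 1) {u : ℝ}
    (hu : ∀ y : ℤ, u ≤ pot v α I k (n + (p : ℤ) ^ k * y)) (hul : u ≤ geom p (l + 1)) :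
    ratio p l * u ≤ mass v α I k n := by
  induction l generalizing I k n u with
  | zero =>
    have := sub_geom_le_mass hv hp hk hI hu hul
    simpa [ratio, geom] using this
  | succ l ih =>
    rcases le_or_gt u 0 with hu0 | hu0
    · exact (mul_nonpos_of_nonneg_of_nonpos (ratio_nonneg p _) hu0).trans (mass_nonneg hI)
    have h1 := sub_geom_le_mass hv hp hk hI hu hul
    have h2 : ∀ j ∈ Finset.range p,
        ratio p l * (u - mass v α I k n) ≤ (child p v α I k n j).card := fun j _ =>
      (ih (by omega) lt_of_mem_child (sub_mass_le_pot_child hv (by omega) hu j)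
        (by linarith)).trans (mass_le_card _ _ _ _)
    have h3 := (Finset.card_nsmul_le_sum _ _ _ h2).trans
      (sum_card_child_le_mass hv hp (by omega) hI)
    rw [Finset.card_range, nsmul_eq_mul] at h3
    have h4 := ratio_nonneg p l
    have h5 : 0 < 1 + p * ratio p l := by positivity
    refine le_of_mul_le_mul_right ?_ h5
    rw [mul_right_comm, ratio_succ_mul]
    linarith

theorem ratio_mul_mul_le {p l : ℕ} {u w A B : ℝ} (hA : ratio p (l + 1) * u ≤ A)
    (hB : ratio p (l + 1) * w ≤ B) :
    ratio p (l + 1) * u * w ≤ A * B + p * (ratio p l * (u - A) * (w - B)) := by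
  have h := ratio_succ_mul p l
  have h4 := ratio_nonneg p l
  set c := ratio p (l + 1)
  set q := p * ratio p l with hq
  have hq0 : 0 ≤ q := by positivity
  have h1 : A * B + p * (ratio p l * (u - A) * (w - B)) - c * u * w
      = (1 + q) * ((A - c * u) * (B - c * w)) := by
    have h2 : p * (ratio p l * (u - A) * (w - B)) = q * ((u - A) * (w - B)) := by
      rw [hq]; ring
    rw [h2]
    linear_combination (u * B + w * A - u * w * (1 + c)) * h
  have := mul_nonneg (by linarith : 0 ≤ 1 + q)
    (mul_nonneg (sub_nonneg.2 hA) (sub_nonneg.2 hB))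
  linarith

/-! ### Lower bounds for the energy by induction on levels -/

theorem energy_nonneg (hv : IsTruncatedDepth p M v) {α : ι → K} {β : κ → K}
    {I : Finset ι} {J : Finset κ} {k : ℕ} {n : ℤ}
    (hI : ∀ i ∈ I, (k : ℝ) < v ((n : K) - α i) + 1)
    (hJ : ∀ i ∈ J, (k : ℝ) < v ((n : K) - β i) + 1) : 0 ≤ energy v α β I J k := by
  refine Finset.sum_nonneg fun i hi => Finset.sum_nonneg fun j hj => ?_
  have h2 := hv.triangle (α i) (n : K) (β j)
  rw [hv.sub_comm (α i)] at h2
  have := (lt_min (sub_lt_iff_lt_add.2 (hI i hi)) (sub_lt_iff_lt_add.2 (hJ j hj))).trans_le h2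
  linarith

theorem ratio_mul_le_energy (hv : IsTruncatedDepth p M v) (hp : p ≠ 0) (l : ℕ) {α : ι → K}
    {β : κ → K} {I : Finset ι} {J : Finset κ} {k : ℕ} {n : ℤ} (hk : k + l + 1 ≤ M)
    (hI : ∀ i ∈ I, (k : ℝ) < v ((n : K) - α i) + 1)
    (hJ : ∀ i ∈ J, (k : ℝ) < v ((n : K) - β i) + 1) {u w : ℝ} (hu0 : 0 ≤ u) (hw0 : 0 ≤ w)
    (hu : ∀ y : ℤ, u ≤ pot v α I k (n + (p : ℤ) ^ k * y)) (hul : u ≤ geom p (l + 1))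
    (hw : ∀ y : ℤ, w ≤ pot v β J k (n + (p : ℤ) ^ k * y)) (hwl : w ≤ geom p (l + 1)) :
    ratio p l * u * w ≤ energy v α β I J k := by
  induction l generalizing I J k n u w with
  | zero =>
    have hA := ratio_mul_le_mass hv hp 0 hk hI hu hul
    have hB := ratio_mul_le_mass hv hp 0 hk hJ hw hwl
    have hE := mass_mul_mass_add_le_energy hv hp (by omega : k ≤ M) hI hJ
    have h1 := Finset.sum_nonneg fun j (_ : j ∈ Finset.range p) =>
      energy_nonneg hv (lt_of_mem_child (p := p) (I := I) (v := v) (α := α) (k := k) (n := n)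
        (j := j)) (lt_of_mem_child (I := J) (α := β))
    rw [ratio, one_mul] at hA hB
    rw [ratio, one_mul]
    linarith [mul_le_mul hA hB hw0 (hu0.trans hA)]
  | succ l ih =>
    have hA := ratio_mul_le_mass hv hp _ hk hI hu hul
    have hB := ratio_mul_le_mass hv hp _ hk hJ hw hwl
    have hA' := sub_geom_le_mass hv hp hk hI hu hul
    have hB' := sub_geom_le_mass hv hp hk hJ hw hwl
    have hE := mass_mul_mass_add_le_energy hv hp (by omega : k ≤ M) hI hJ
    set A := mass v α I k n
    set B := mass v β J k n
    have hc1 := ratio_le_one p (l + 1)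
    have hc0 := ratio_nonneg p (l + 1)
    by_cases hAB : A < u ∧ B < w
    · have h2 : ∀ j ∈ Finset.range p, ratio p l * (u - A) * (w - B) ≤
          energy v α β (child p v α I k n j) (child p v β J k n j) (k + 1) := fun j _ =>
        ih (by omega) lt_of_mem_child lt_of_mem_child (by linarith) (by linarith)
          (sub_mass_le_pot_child hv (by omega) hu j) (by linarith)
          (sub_mass_le_pot_child hv (by omega) hw j) (by linarith)
      have h3 := Finset.card_nsmul_le_sum _ _ _ h2
      rw [Finset.card_range, nsmul_eq_mul] at h3
      linarith [ratio_mul_mul_le hA hB]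
    -- Some child bound is nonpositive, so the induction hypothesis is unavailable; the product of
    -- the masses already suffices.
    · have h1 := Finset.sum_nonneg fun j (_ : j ∈ Finset.range p) =>
        energy_nonneg hv (lt_of_mem_child (p := p) (I := I) (v := v) (α := α) (k := k) (n := n)
          (j := j)) (lt_of_mem_child (I := J) (α := β))
      have h2 : ratio p (l + 1) * u * w ≤ A * B := by
        rcases not_and_or.1 hAB with h | h
        · have := mul_le_mul (not_lt.1 h) hB (by positivity) (hu0.trans (not_lt.1 h))
          linarith
        · have := mul_le_mul hA (not_lt.1 h) hw0 ((mul_nonneg hc0 hu0).trans hA)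
          linarith
      linarith

/-- Here `A`, `B` are masses, `P` the energy and `UB` the potential of the dominated family. If `A <
1`, then `u ≤ 1` and `h1` suffices; otherwise `h2` does. -/
theorem add_le_of_dominates {c u w A B D P UB : ℝ} (hc0 : 0 ≤ c) (hc1 : c ≤ 1)
    (hu : 0 ≤ u) (hw : 0 ≤ w)
    (hA : c * u ≤ A) (hB : c * w ≤ B) (hA1 : A < u → 1 ≤ A) (hAB : u ≤ A ∨ w ≤ B)
    (hUB : w + D ≤ UB) (h1 : UB ≤ P) (h2 : A * B + UB - B ≤ P) : c * u * w + D ≤ P := by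
  have hA0 : 0 ≤ A := (mul_nonneg hc0 hu).trans hA
  have hB0 : 0 ≤ B := (mul_nonneg hc0 hw).trans hB
  have hcu : c * u ≤ u := mul_le_of_le_one_left hu hc1
  rcases lt_or_ge A 1 with hA' | hA'
  · have hu1 : u ≤ 1 := by
      by_contra! h
      exact (hA1 (hA'.trans h)).not_gt hA'
    have : c * u * w ≤ 1 * w := mul_le_mul_of_nonneg_right (hcu.trans hu1) hw
    linarith
  · rcases lt_or_ge B w with hB' | hB'
    · have hu' := hAB.resolve_right hB'.not_ge
      have := mul_le_mul hu' hB (mul_nonneg hc0 hw) hA0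
      linarith
    · have h3 := mul_le_mul_of_nonneg_left hB' (sub_nonneg.2 hA')
      have h4 := mul_le_mul_of_nonneg_right hA hw
      linarith

theorem ratio_mul_add_le_energy (hv : IsTruncatedDepth p M v) (hp : p ≠ 0) (l : ℕ) {α : ι → K}
    {β : κ → K} {I : Finset ι} {J : Finset κ} {k : ℕ} {n : ℤ} (hk : k + l + 1 ≤ M)
    (hI : ∀ i ∈ I, (k : ℝ) < v ((n : K) - α i) + 1)
    (hJ : ∀ i ∈ J, (k : ℝ) < v ((n : K) - β i) + 1) {u w D : ℝ} (hu0 : 0 ≤ u) (hw0 : 0 ≤ w)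
    (hu : ∀ y : ℤ, u ≤ pot v α I k (n + (p : ℤ) ^ k * y)) (hul : u ≤ geom p (l + 1))
    (hw : ∀ y : ℤ, w ≤ pot v β J k (n + (p : ℤ) ^ k * y)) (hwl : w ≤ geom p (l + 1))
    (huD : u + D ≤ pot v α I k n) (hwD : w + D ≤ pot v β J k n) :
    ratio p l * u * w + D ≤ energy v α β I J k := by
  have hp1 : (1 : ℝ) ≤ p := Nat.one_le_cast.2 (Nat.one_le_iff_ne_zero.2 hp)
  induction l generalizing I J k n u w with
  | zero =>
    have hA := ratio_mul_le_mass hv hp 0 hk hI hu hul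
    have hB := ratio_mul_le_mass hv hp 0 hk hJ hw hwl
    have hA' : u ≤ mass v α I k n := by simpa [ratio] using hA
    have hB' : w ≤ mass v β J k n := by simpa [ratio] using hB
    rcases pot_le_energy_or hv hI hJ with ⟨h1, h2⟩ | ⟨h1, h2⟩
    · exact add_le_of_dominates (ratio_nonneg p 0) (ratio_le_one p 0) hu0 hw0 hA hB
        (fun h => absurd hA' h.not_ge) (.inl hA') hwD h1 h2
    · rw [mul_right_comm]
      exact add_le_of_dominates (ratio_nonneg p 0) (ratio_le_one p 0) hw0 hu0 hB hA
        (fun h => absurd hB' h.not_ge) (.inl hB') huD h1 h2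
  | succ l ih =>
    have hA := ratio_mul_le_mass hv hp _ hk hI hu hul
    have hB := ratio_mul_le_mass hv hp _ hk hJ hw hwl
    have hA' := sub_geom_le_mass hv hp hk hI hu hul
    have hB' := sub_geom_le_mass hv hp hk hJ hw hwl
    -- A mass below its bound is at least `p`, which supplies the hypothesis `A < u → 1 ≤ A`.
    have hA1 := min_le_mass hv hp 0 (by omega) hI hu
    have hB1 := min_le_mass hv hp 0 (by omega) hJ hw
    simp only [geom, Finset.sum_range_zero, sub_zero, zero_add, pow_one, min_le_iff] at hA1 hB1
    have hE := mass_mul_mass_add_le_energy hv hp (by omega : k ≤ M) hI hJ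
    have hor := pot_le_energy_or hv hI hJ
    by_cases hAB : mass v α I k n < u ∧ mass v β J k n < w
    -- Only the child `j = 0` contains `n` and inherits the surplus `D`.
    · have h2 : ∀ j ∈ Finset.range p,
          ratio p l * (u - mass v α I k n) * (w - mass v β J k n) + (if j = 0 then D else 0) ≤
          energy v α β (child p v α I k n j) (child p v β J k n j) (k + 1) := by
        intro j _
        split_ifs with hj
        · subst hj
          refine ih (n := n + (p : ℤ) ^ k * (0 : ℕ)) (by omega) lt_of_mem_child lt_of_mem_child
            (by linarith) (by linarith)
            (sub_mass_le_pot_child hv (by omega) hu 0) (by linarith)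
            (sub_mass_le_pot_child hv (by omega) hw 0) (by linarith) ?_ ?_
          · have := pot_sub_mass_le_pot_child hv α I n (by omega : k + 1 ≤ M) 0 0
            simp only [Nat.cast_zero, mul_zero, add_zero] at this ⊢
            linarith
          · have := pot_sub_mass_le_pot_child hv β J n (by omega : k + 1 ≤ M) 0 0
            simp only [Nat.cast_zero, mul_zero, add_zero] at this ⊢
            linarith
        · rw [add_zero]
          exact ratio_mul_le_energy hv hp l (by omega) lt_of_mem_child lt_of_mem_child
            (by linarith) (by linarith)
            (sub_mass_le_pot_child hv (by omega) hu j) (by linarith)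
            (sub_mass_le_pot_child hv (by omega) hw j) (by linarith)
      have h3 := Finset.sum_le_sum h2
      rw [Finset.sum_add_distrib, Finset.sum_const, Finset.card_range, nsmul_eq_mul,
        Finset.sum_ite_eq' , if_pos (Finset.mem_range.2 (Nat.pos_of_ne_zero hp))] at h3
      linarith [ratio_mul_mul_le hA hB]
    · have hAB' : u ≤ mass v α I k n ∨ w ≤ mass v β J k n := by
        simpa only [not_and_or, not_lt] using hAB
      rcases hor with ⟨h1, h2⟩ | ⟨h1, h2⟩
      · exact add_le_of_dominates (ratio_nonneg p _) (ratio_le_one p _) hu0 hw0 hA hB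
          (fun h => hp1.trans (hA1.resolve_left h.not_ge)) hAB' hwD h1 h2
      · rw [mul_right_comm]
        exact add_le_of_dominates (ratio_nonneg p _) (ratio_le_one p _) hw0 hu0 hB hA
          (fun h => hp1.trans (hB1.resolve_left h.not_ge)) hAB'.symm huD h1 h2

/-- The lower bound for the sum of all depths of differences of two families of points, all of
them integral. -/
theorem sum_depth_ge [Fintype ι] [Fintype κ] (hv : IsTruncatedDepth p M v) (hp : p ≠ 0) (l : ℕ)
    {α : ι → K} {β : κ → K} (hl : l + 2 ≤ M)
    (hα : ∀ i (x : ℤ), 0 ≤ v ((x : K) - α i)) (hβ : ∀ i (x : ℤ), 0 ≤ v ((x : K) - β i))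
    {s D : ℝ} (hs : 0 ≤ s) (hsl : s ≤ geom p (l + 1))
    (hsα : ∀ x : ℤ, s ≤ ∑ i, v ((x : K) - α i)) (hsβ : ∀ x : ℤ, s ≤ ∑ i, v ((x : K) - β i))
    (n : ℤ) (hDα : s + D ≤ ∑ i, v ((n : K) - α i)) (hDβ : s + D ≤ ∑ i, v ((n : K) - β i)) :
    p * ratio p l * s ^ 2 + D ≤ ∑ i, ∑ j, v (α i - β j) := by
  have hI : ∀ i ∈ (Finset.univ : Finset ι), ((0 : ℕ) : ℝ) < v ((n : K) - α i) + 1 :=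
    fun i _ => by have := hα i n; push_cast; linarith
  have hJ : ∀ i ∈ (Finset.univ : Finset κ), ((0 : ℕ) : ℝ) < v ((n : K) - β i) + 1 :=
    fun i _ => by have := hβ i n; push_cast; linarith
  have hE := mass_mul_mass_add_le_energy hv hp (by omega : 0 ≤ M) hI hJ
  -- At level 0 integrality gives every point full mass. The product of cardinalities then cancels
  -- against the shift by 1 in the energy, and the children keep the bound `s` undiminished.
  have hmα : mass v α Finset.univ 0 n = Fintype.card ι := by
    simp [mass, hα]
  have hmβ : mass v β Finset.univ 0 n = Fintype.card κ := by
    simp [mass, hβ]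
  have hpα : ∀ x, pot v α Finset.univ 0 x = (∑ i, v ((x : K) - α i)) + Fintype.card ι := by
    simp [pot, Finset.sum_add_distrib]
  have hpβ : ∀ x, pot v β Finset.univ 0 x = (∑ i, v ((x : K) - β i)) + Fintype.card κ := by
    simp [pot, Finset.sum_add_distrib]
  have hen : energy v α β Finset.univ Finset.univ 0 =
      (∑ i, ∑ j, v (α i - β j)) + Fintype.card ι * Fintype.card κ := by
    simp [energy, Finset.sum_add_distrib]
  have h1 : ∀ j (y : ℤ), s ≤ pot v α (child p v α Finset.univ 0 n j) (0 + 1)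
      (n + (p : ℤ) ^ 0 * j + (p : ℤ) ^ (0 + 1) * y) := fun j y => by
    have := pot_sub_mass_le_pot_child hv α Finset.univ n (by omega : 0 + 1 ≤ M) j y
    rw [hpα, hmα] at this
    linarith [hsα (n + (p : ℤ) ^ 0 * j + (p : ℤ) ^ (0 + 1) * y)]
  have h2 : ∀ j (y : ℤ), s ≤ pot v β (child p v β Finset.univ 0 n j) (0 + 1)
      (n + (p : ℤ) ^ 0 * j + (p : ℤ) ^ (0 + 1) * y) := fun j y => by
    have := pot_sub_mass_le_pot_child hv β Finset.univ n (by omega : 0 + 1 ≤ M) j y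
    rw [hpβ, hmβ] at this
    linarith [hsβ (n + (p : ℤ) ^ 0 * j + (p : ℤ) ^ (0 + 1) * y)]
  have h3 : ∀ j ∈ Finset.range p, ratio p l * s * s + (if j = 0 then D else 0) ≤
      energy v α β (child p v α Finset.univ 0 n j) (child p v β Finset.univ 0 n j) (0 + 1) := by
    intro j _
    split_ifs with hj
    · subst hj
      refine ratio_mul_add_le_energy hv hp l (n := n + (p : ℤ) ^ 0 * (0 : ℕ)) (by omega)
        lt_of_mem_child lt_of_mem_child hs hs (h1 0) hsl (h2 0) hsl ?_ ?_
      · have := pot_sub_mass_le_pot_child hv α Finset.univ n (by omega : 0 + 1 ≤ M) 0 0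
        rw [hpα, hmα] at this
        simp only [Nat.cast_zero, mul_zero, add_zero] at this ⊢
        linarith
      · have := pot_sub_mass_le_pot_child hv β Finset.univ n (by omega : 0 + 1 ≤ M) 0 0
        rw [hpβ, hmβ] at this
        simp only [Nat.cast_zero, mul_zero, add_zero] at this ⊢
        linarith
    · rw [add_zero]
      exact ratio_mul_le_energy hv hp l (by omega) lt_of_mem_child lt_of_mem_child hs hs
        (h1 j) hsl (h2 j) hsl
  have h4 := Finset.sum_le_sum h3
  rw [Finset.sum_add_distrib, Finset.sum_const, Finset.card_range, nsmul_eq_mul,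
    Finset.sum_ite_eq', if_pos (Finset.mem_range.2 (Nat.pos_of_ne_zero hp))] at h4
  rw [hen, hmα, hmβ] at hE
  linarith

end RootTree

/-! ### Truncated valuations of roots, and the resultant -/

open Polynomial

section Depth

variable (p : ℕ) [hp : Fact p.Prime]

/-- The `p`-adic valuation on the algebraic closure of `ℚ_[p]`, truncated at `M`. -/
noncomputable def truncDepth (M : ℕ) (z : PadicAlgCl p) : ℝ :=
  -Real.logb p (max ‖z‖ ((p : ℝ) ^ (-M : ℤ)))

variable {p}

theorem one_lt_cast_of_fact : (1 : ℝ) < p := mod_cast hp.out.one_lt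

theorem max_norm_pos (M : ℕ) (z : PadicAlgCl p) : 0 < max ‖z‖ ((p : ℝ) ^ (-M : ℤ)) :=
  lt_max_of_lt_right (zpow_pos (by linarith [one_lt_cast_of_fact (p := p)]) _)

theorem le_truncDepth_iff {M : ℕ} {z : PadicAlgCl p} {t : ℝ} :
    t ≤ truncDepth p M z ↔ max ‖z‖ ((p : ℝ) ^ (-M : ℤ)) ≤ (p : ℝ) ^ (-t) := by
  rw [truncDepth, le_neg, Real.logb_le_iff_le_rpow one_lt_cast_of_fact (max_norm_pos M z)]

theorem natCast_le_truncDepth_iff {M k : ℕ} {z : PadicAlgCl p} (hk : k ≤ M) :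
    (k : ℝ) ≤ truncDepth p M z ↔ ‖z‖ ≤ (p : ℝ) ^ (-k : ℤ) := by
  rw [le_truncDepth_iff, max_le_iff, ← Real.rpow_intCast, ← Real.rpow_intCast]
  push_cast
  refine and_iff_left (Real.rpow_le_rpow_of_exponent_le one_lt_cast_of_fact.le ?_)
  simpa using hk

theorem truncDepth_nonneg {M : ℕ} {z : PadicAlgCl p} (hz : ‖z‖ ≤ 1) : 0 ≤ truncDepth p M z := by
  have := (natCast_le_truncDepth_iff (p := p) (z := z) (Nat.zero_le M)).2 (by simpa using hz)
  simpa using this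

theorem truncDepth_le (M : ℕ) {z : PadicAlgCl p} (hz : z ≠ 0) :
    truncDepth p M z ≤ -Real.logb p ‖z‖ :=
  neg_le_neg (Real.logb_le_logb_of_le one_lt_cast_of_fact (norm_pos_iff.2 hz) (le_max_left _ _))

theorem truncDepth_eq {M : ℕ} {z : PadicAlgCl p} (hz : (p : ℝ) ^ (-M : ℤ) ≤ ‖z‖) :
    truncDepth p M z = -Real.logb p ‖z‖ := by
  rw [truncDepth, max_eq_left hz]

theorem norm_intCast_padicAlgCl (n : ℤ) : ‖(n : PadicAlgCl p)‖ = ‖(n : ℚ_[p])‖ := by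
  rw [← PadicAlgCl.norm_extends, map_intCast]

theorem norm_intCast_le_iff {n : ℤ} {k : ℕ} :
    ‖(n : PadicAlgCl p)‖ ≤ (p : ℝ) ^ (-k : ℤ) ↔ (p : ℤ) ^ k ∣ n := by
  rw [norm_intCast_padicAlgCl, Padic.norm_int_le_pow_iff_dvd]

theorem le_norm_intCast_of_not_dvd {n : ℤ} {k : ℕ} (h : ¬ (p : ℤ) ^ (k + 1) ∣ n) :
    (p : ℝ) ^ (-k : ℤ) ≤ ‖(n : PadicAlgCl p)‖ := by
  by_contra! h2
  refine h (norm_intCast_le_iff.1 ?_)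
  rw [norm_intCast_padicAlgCl] at h2 ⊢
  rw [Padic.norm_le_pow_iff_norm_lt_pow_add_one]
  rwa [show -((k + 1 : ℕ) : ℤ) + 1 = -k by push_cast; ring]

theorem isTruncatedDepth_truncDepth (M : ℕ) : IsTruncatedDepth p M (truncDepth p M) where
  neg a := by simp [truncDepth]
  add a b := by
    rw [le_truncDepth_iff]
    have ha := le_truncDepth_iff.1 (min_le_left (truncDepth p M a) (truncDepth p M b))
    have hb := le_truncDepth_iff.1 (min_le_right (truncDepth p M a) (truncDepth p M b))
    exact max_le ((PadicAlgCl.isNonarchimedean p a b).trans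
      (max_le ((le_max_left _ _).trans ha) ((le_max_left _ _).trans hb)))
      ((le_max_right _ _).trans ha)
  le_of_dvd k n hk h := (natCast_le_truncDepth_iff hk).2 (norm_intCast_le_iff.2 h)
  le_of_not_dvd k n h := by
    rw [truncDepth, neg_le, Real.le_logb_iff_rpow_le one_lt_cast_of_fact (max_norm_pos M _)]
    refine le_max_of_le_left (le_trans (le_of_eq ?_) (le_norm_intCast_of_not_dvd h))
    rw [← Real.rpow_intCast]
    push_cast
    rfl

theorem norm_le_one_of_isIntegral {z : PadicAlgCl p} (hz : IsIntegral ℤ z) : ‖z‖ ≤ 1 := by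
  have h := (Valuation.integer.integers
    (NormedField.valuation (K := PadicAlgCl p))).mem_of_integral (x := z) hz.tower_top
  rw [Valuation.mem_integer_iff, NormedField.valuation_apply] at h
  exact_mod_cast h

/-- Truncation is harmless: one truncated factor alone contributes `M ≥ t`, and otherwise all depths
are exact and add up. -/
theorem natCast_le_sum_truncDepth {ι : Type*} [Fintype ι] {M t : ℕ} (ht : t ≤ M)
    {z : ι → PadicAlgCl p} (hz : ∀ i, ‖z i‖ ≤ 1) (h : ‖∏ i, z i‖ ≤ (p : ℝ) ^ (-t : ℤ)) :
    (t : ℝ) ≤ ∑ i, truncDepth p M (z i) := by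
  by_cases hex : ∃ i, ‖z i‖ ≤ (p : ℝ) ^ (-M : ℤ)
  · obtain ⟨i, hi⟩ := hex
    calc (t : ℝ) ≤ M := Nat.cast_le.2 ht
      _ ≤ truncDepth p M (z i) := (natCast_le_truncDepth_iff le_rfl).2 hi
      _ ≤ _ := Finset.single_le_sum (f := fun i => truncDepth p M (z i))
        (fun i _ => truncDepth_nonneg (hz i)) (Finset.mem_univ i)
  · push Not at hex
    have hp0 : (0 : ℝ) < p := zero_lt_one.trans one_lt_cast_of_fact
    have hpos : ∀ i, 0 < ‖z i‖ := fun i => (zpow_pos hp0 _).trans (hex i)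
    rw [Finset.sum_congr rfl fun i _ => truncDepth_eq (hex i).le, Finset.sum_neg_distrib,
      ← Real.logb_prod _ _ fun i _ => (hpos i).ne', ← norm_prod, le_neg,
      Real.logb_le_iff_le_rpow one_lt_cast_of_fact
        (by rw [norm_prod]; exact Finset.prod_pos fun i _ => hpos i)]
    rw [← Real.rpow_intCast] at h
    push_cast at h
    exact h

/-- A monic integer polynomial as a product over a finite family of integral elements. -/
theorem exists_roots_family {f : ℤ[X]} (hf : f.Monic) :
    ∃ (m : ℕ) (α : Fin m → PadicAlgCl p), (∀ i, ‖α i‖ ≤ 1) ∧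
      (f.map (Int.castRingHom (PadicAlgCl p))).roots = Finset.univ.val.map α ∧
      ∀ x, (f.map (Int.castRingHom (PadicAlgCl p))).eval x = ∏ i, (x - α i) := by
  set F := f.map (Int.castRingHom (PadicAlgCl p)) with hF
  have hFm : F.Monic := hf.map _
  obtain ⟨L, hL⟩ := Quotient.exists_rep F.roots
  have hroots : F.roots = Finset.univ.val.map L.get := by
    rw [Fin.univ_val_map, List.ofFn_get, ← hL]
    rfl
  refine ⟨L.length, L.get, fun i => ?_, hroots, fun x => ?_⟩
  · have hmem : L.get i ∈ F.roots := by
      rw [hroots]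
      exact Multiset.mem_map_of_mem _ (Finset.mem_univ i)
    refine norm_le_one_of_isIntegral ⟨f, hf, ?_⟩
    have := (mem_roots'.1 hmem).2
    rwa [IsRoot, hF, eval_map] at this
  · rw [(IsAlgClosed.splits F).eval_eq_prod_roots_of_monic hFm, hroots, Multiset.map_map]
    rfl

theorem natCast_le_intVal_iff {n : ℤ} {k : ℕ} :
    (k : ℕ∞) ≤ intVal p n ↔ ‖(n : PadicAlgCl p)‖ ≤ (p : ℝ) ^ (-k : ℤ) := by
  rw [norm_intCast_le_iff, pow_dvd_iff_le_emultiplicity, intVal]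

theorem exists_intVal_eq {n : ℤ} (hn : n ≠ 0) :
    ∃ a : ℕ, intVal p n = a ∧ -Real.logb p ‖(n : PadicAlgCl p)‖ ≤ a := by
  have hfin : FiniteMultiplicity (p : ℤ) n :=
    Int.finiteMultiplicity_iff.2 ⟨by simpa using hp.out.ne_one, hn⟩
  refine ⟨multiplicity (p : ℤ) n, hfin.emultiplicity_eq_multiplicity, ?_⟩
  have h := le_norm_intCast_of_not_dvd
    (hfin.not_pow_dvd_of_multiplicity_lt (Nat.lt_succ_self (multiplicity (p : ℤ) n)))
  rw [neg_le, Real.le_logb_iff_rpow_le one_lt_cast_of_fact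
    (norm_pos_iff.2 (Int.cast_ne_zero.2 hn))]
  rw [← Real.rpow_intCast] at h
  push_cast at h
  exact h

/-- The lower bound for the valuation of a resultant, in terms of a number of levels. -/
theorem resultant_intVal_ge {f g : ℤ[X]} (hf : f.Monic) (hg : g.Monic) {s D l : ℕ}
    (hfs : ∀ n : ℤ, (s : ℕ∞) ≤ intVal p (f.eval n))
    (hgs : ∀ n : ℤ, (s : ℕ∞) ≤ intVal p (g.eval n))
    (hsl : (s : ℝ) ≤ RootTree.geom p (l + 1)) (n : ℤ)
    (hfn : ((s + D : ℕ) : ℕ∞) ≤ intVal p (f.eval n))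
    (hgn : ((s + D : ℕ) : ℕ∞) ≤ intVal p (g.eval n)) (hr : resultant f g ≠ 0) :
    ∃ a : ℕ, intVal p (resultant f g) = a ∧
      p * RootTree.ratio p l * (s : ℝ) ^ 2 + D ≤ a := by
  obtain ⟨a, ha, ha'⟩ := exists_intVal_eq (p := p) hr
  refine ⟨a, ha, ?_⟩
  set φ := Int.castRingHom (PadicAlgCl p) with hφ
  obtain ⟨m, α, hα, hfr, hfe⟩ := exists_roots_family (p := p) hf
  obtain ⟨m', β, hβ, -, hge⟩ := exists_roots_family (p := p) hg
  have hres : ((resultant f g : ℤ) : PadicAlgCl p) = ∏ i, ∏ j, (α i - β j) := by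
    have h := resultant_eq_prod_eval (f.map φ) (g.map φ) g.natDegree natDegree_map_le
      (IsAlgClosed.splits _)
    rw [(hf.map φ).leadingCoeff, one_pow, one_mul, hf.natDegree_map, resultant_map_map, hfr,
      Multiset.map_map] at h
    rw [← eq_intCast φ, h, ← Finset.prod_eq_multiset_prod]
    exact Finset.prod_congr rfl fun i _ => hge (α i)
  have hne : ∀ i j, α i - β j ≠ 0 := by
    have h0 : ((resultant f g : ℤ) : PadicAlgCl p) ≠ 0 := Int.cast_ne_zero.2 hr
    rw [hres] at h0
    intro i j
    exact Finset.prod_ne_zero_iff.1 (Finset.prod_ne_zero_iff.1 h0 i (Finset.mem_univ i)) j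
      (Finset.mem_univ j)
  have hint : ∀ (x : ℤ) {z : PadicAlgCl p}, ‖z‖ ≤ 1 → ‖(x : PadicAlgCl p) - z‖ ≤ 1 := by
    intro x z hz
    rw [sub_eq_add_neg]
    refine (PadicAlgCl.isNonarchimedean p _ _).trans (max_le ?_ (by rwa [norm_neg]))
    rw [norm_intCast_padicAlgCl]
    exact Padic.norm_int_le_one x
  have hval : ∀ {h : ℤ[X]} {d : ℕ} {γ : Fin d → PadicAlgCl p} {t M : ℕ} {x : ℤ},
      (∀ i, ‖γ i‖ ≤ 1) → (∀ x, (h.map φ).eval x = ∏ i, (x - γ i)) → t ≤ M →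
      (t : ℕ∞) ≤ intVal p (h.eval x) →
      (t : ℝ) ≤ ∑ i, truncDepth p M ((x : PadicAlgCl p) - γ i) := by
    intro h d γ t M x hγ he ht hle
    refine natCast_le_sum_truncDepth ht (fun i => hint x (hγ i)) ?_
    rw [← he, eval_intCast_map, eq_intCast]
    exact natCast_le_intVal_iff.1 hle
  -- Large enough for the depth bounds `s` and `s + D`, and for the `l + 2` levels of the tree.
  set M := s + D + l + 2
  have key := RootTree.sum_depth_ge (isTruncatedDepth_truncDepth (p := p) M) hp.out.ne_zero l
    (α := α) (β := β) (by omega) (fun i x => truncDepth_nonneg (hint x (hα i)))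
    (fun i x => truncDepth_nonneg (hint x (hβ i))) (Nat.cast_nonneg s) hsl (D := D)
    (fun x => hval hα hfe (by omega) (hfs x)) (fun x => hval hβ hge (by omega) (hgs x)) n
    (by have := hval (M := M) hα hfe (by omega) hfn; push_cast at this; exact this)
    (by have := hval (M := M) hβ hge (by omega) hgn; push_cast at this; exact this)
  refine (key.trans ?_).trans ha'
  rw [hres, norm_prod, Real.logb_prod _ _ fun i _ => norm_ne_zero_iff.2
    (Finset.prod_ne_zero_iff.2 fun j _ => hne i j), ← Finset.sum_neg_distrib]
  refine Finset.sum_le_sum fun i _ => ?_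
  rw [norm_prod, Real.logb_prod _ _ fun j _ => norm_ne_zero_iff.2 (hne i j),
    ← Finset.sum_neg_distrib]
  exact Finset.sum_le_sum fun j _ => truncDepth_le M (hne i j)

end Depth

/-! ### Closed form of the constant -/

theorem RootTree.ratio_mul_eq (p l : ℕ) :
    RootTree.ratio p l * ((p : ℝ) ^ (l + 1) - 1) = (p : ℝ) ^ l * (p - 1) := by
  induction l with
  | zero => simp [RootTree.ratio]
  | succ l ih =>
    have h := RootTree.ratio_succ_mul p l
    have h1 : (1 + p * RootTree.ratio p l) * ((p : ℝ) ^ (l + 1) - 1) = (p : ℝ) ^ (l + 2) - 1 := by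
      linear_combination (p : ℝ) * ih
    calc RootTree.ratio p (l + 1) * ((p : ℝ) ^ (l + 1 + 1) - 1)
        = RootTree.ratio p (l + 1) * (1 + p * RootTree.ratio p l) * ((p : ℝ) ^ (l + 1) - 1) := by
          rw [mul_assoc, h1]
      _ = _ := by rw [h]; linear_combination (p : ℝ) * ih

theorem RootTree.geom_mul_sub_one (p l : ℕ) :
    RootTree.geom p l * ((p : ℝ) - 1) = (p : ℝ) ^ (l + 1) - p := by
  rw [RootTree.geom]
  induction l with
  | zero => simp
  | succ l ih =>
    rw [Finset.sum_range_succ, add_mul, ih]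
    ring

/-- The hypothesis says `s < geom p L + 1`; both `s` and `geom p L` are integers. -/
theorem RootTree.le_geom_of_lt {p s L : ℕ} (hp : 1 < p)
    (h : ((p : ℝ) - 1) * s + 1 < (p : ℝ) ^ (L + 1)) : (s : ℝ) ≤ RootTree.geom p L := by
  have hp1 : (0 : ℝ) < p - 1 := by
    have : (1 : ℝ) < p := mod_cast hp
    linarith
  have h1 := RootTree.geom_mul_sub_one p L
  have h2 : (s : ℝ) < RootTree.geom p L + 1 := by
    refine lt_of_mul_lt_mul_right ?_ hp1.le
    linarith
  have h3 : RootTree.geom p L = ((∑ i ∈ Finset.range L, p ^ (i + 1) : ℕ) : ℝ) := by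
    rw [RootTree.geom]
    push_cast
    rfl
  rw [h3] at h2 ⊢
  exact_mod_cast Nat.lt_succ_iff.1 (by exact_mod_cast h2)

/-- The number of levels that is optimal for a given `s`, with the closed form of the bound. -/
theorem RootTree.exists_levels {p : ℕ} (hp : 1 < p) (s : ℕ) : ∃ l : ℕ,
    (s : ℝ) ≤ RootTree.geom p (l + 1) ∧
    (p : ℝ) * (s : ℝ) ^ 2 * (((p : ℝ) - 1) /
      ((p : ℝ) - (p : ℝ) ^ (1 - ⌊Real.logb (p : ℝ) (((p : ℝ) - 1) * (s : ℝ) + 1)⌋ : ℤ))) =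
      p * RootTree.ratio p l * (s : ℝ) ^ 2 := by
  have hp1 : (1 : ℝ) < p := mod_cast hp
  have hp0 : (0 : ℝ) < p := by linarith
  rcases Nat.eq_zero_or_pos s with rfl | hs
  -- For `s = 0` the factor `s ^ 2` kills both sides, whatever the quotient with zero denominator
  -- is.
  · exact ⟨0, by simp [RootTree.geom], by simp⟩
  have hs1 : (1 : ℝ) ≤ s := mod_cast hs
  have hpos : 0 < ((p : ℝ) - 1) * s + 1 := by nlinarith
  set z := ⌊Real.logb (p : ℝ) (((p : ℝ) - 1) * (s : ℝ) + 1)⌋ with hz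
  have hz1 : 1 ≤ z := by
    rw [hz, Int.le_floor, Real.le_logb_iff_rpow_le hp1 hpos]
    simp only [Int.cast_one, Real.rpow_one]
    nlinarith
  -- `s ≥ 1` forces `z ≥ 1`; this `l` turns `p ^ (1 - z)` into `p ^ (-l)`.
  obtain ⟨l, hl⟩ : ∃ l : ℕ, z = l + 1 := ⟨(z - 1).toNat, by omega⟩
  refine ⟨l, RootTree.le_geom_of_lt hp ?_, ?_⟩
  · have h := Int.lt_floor_add_one (Real.logb (p : ℝ) (((p : ℝ) - 1) * (s : ℝ) + 1))
    rw [← hz, hl, Real.logb_lt_iff_lt_rpow hp1 hpos] at h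
    rw [← Real.rpow_natCast]
    push_cast at h ⊢
    exact h
  · have h1 := RootTree.ratio_mul_eq p l
    have hpow : 1 < (p : ℝ) ^ (l + 1) := one_lt_pow₀ hp1 (by omega)
    have h2 : (p : ℝ) ^ (1 - z) = 1 / (p : ℝ) ^ l := by
      rw [hl, show (1 - ((l : ℤ) + 1)) = -(l : ℤ) by ring, zpow_neg, zpow_natCast, one_div]
    have h3 : (p : ℝ) - 1 / (p : ℝ) ^ l = ((p : ℝ) ^ (l + 1) - 1) / (p : ℝ) ^ l := by
      field_simp
      ring
    have h4 : (p : ℝ) ^ (l + 1) - 1 ≠ 0 := by linarith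
    have h5 : ((p : ℝ) - 1) / ((p : ℝ) - (p : ℝ) ^ (1 - z)) = RootTree.ratio p l := by
      rw [h2, h3, div_div_eq_mul_div, div_eq_iff h4, h1]
      ring
    rw [h5]
    ring

/-! ### Existence of the maximum, and the final bound -/

theorem coe_le_coe_intVal {p : ℕ} {r : ℤ} {x : ℝ}
    (h : r ≠ 0 → ∃ a : ℕ, intVal p r = a ∧ x ≤ a) :
    (x : EReal) ≤ ((intVal p r : ENNReal) : EReal) := by
  rcases eq_or_ne r 0 with rfl | hr
  · simp [intVal]
  · obtain ⟨a, ha, hxa⟩ := h hr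
    rw [ha]
    refine (EReal.coe_le_coe_iff.2 hxa).trans (le_of_eq ?_)
    rw [ENat.toENNReal_coe, ← ENNReal.coe_natCast, EReal.coe_nnreal_eq_coe_real, NNReal.coe_natCast]

theorem mainTheorem4 (p : ℕ) (hp : p.Prime) (f g : Polynomial ℤ) (hf : f.Monic) (hg : g.Monic)
    (s : ℕ) (hfs : ∀ n : ℤ, (s : ℕ∞) ≤ intVal p (f.eval n))
    (hgs : ∀ n : ℤ, (s : ℕ∞) ≤ intVal p (g.eval n)) :
    (Polynomial.resultant f g ≠ 0 → ∃ S : ℕ, IsGreatest (minValSet p f g) (S : ℕ∞)) ∧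
    ∀ S : ℕ, IsGreatest (minValSet p f g) (S : ℕ∞) →
      (((S : ℝ) - (s : ℝ) + (p : ℝ) * (s : ℝ) ^ 2 *
          (((p : ℝ) - 1) /
            ((p : ℝ) - (p : ℝ) ^ (1 - ⌊Real.logb (p : ℝ) (((p : ℝ) - 1) * (s : ℝ) + 1)⌋ : ℤ))) : ℝ)
        : EReal) ≤ ((intVal p (Polynomial.resultant f g) : ENNReal) : EReal) := by
  have : Fact p.Prime := ⟨hp⟩
  constructor
  · intro hr
    -- The case `s = 0` of the resultant bound caps all the minima by `v_p(r)`, so a maximum exists.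
    have hbound : ∀ n : ℤ, ∀ D : ℕ,
        (D : ℕ∞) ≤ min (intVal p (f.eval n)) (intVal p (g.eval n)) →
        (D : ℕ∞) ≤ intVal p (resultant f g) := by
      intro n D hD
      obtain ⟨b, hb, hDb⟩ := resultant_intVal_ge (p := p) (s := 0) (D := D) (l := 0) hf hg
        (by simp) (by simp) (by simp [RootTree.geom]) n
        (by simpa using hD.trans (min_le_left _ _))
        (by simpa using hD.trans (min_le_right _ _)) hr
      rw [hb]
      norm_num at hDb
      exact_mod_cast hDb
    obtain ⟨b, hb, -⟩ := exists_intVal_eq (p := p) hr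
    have hle : ∀ n : ℤ, min (intVal p (f.eval n)) (intVal p (g.eval n)) ≤ b := by
      intro n
      refine ENat.forall_natCast_le_iff_le.1 fun D hD => ?_
      rw [← hb]
      exact hbound n D hD
    have hlift : ∀ n : ℤ, ∃ c : ℕ,
        min (intVal p (f.eval n)) (intVal p (g.eval n)) = c ∧ c ≤ b := fun n => by
      obtain ⟨c, hc⟩ := ENat.ne_top_iff_exists.1
        (ne_top_of_le_ne_top (ENat.natCast_ne_top b) (hle n))
      refine ⟨c, hc.symm, ?_⟩
      have := hle n
      rw [← hc] at this
      exact_mod_cast this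
    choose c hc hcb using hlift
    obtain ⟨_, ⟨n, rfl⟩, hn⟩ := Set.Finite.exists_maximal
      ((Set.finite_Iic b).subset (Set.range_subset_iff.2 hcb)) (Set.range_nonempty c)
    refine ⟨c n, ⟨n, hc n⟩, ?_⟩
    rintro _ ⟨m, rfl⟩
    simp only [hc]
    rcases le_total (c m) (c n) with h | h
    · exact_mod_cast h
    · exact_mod_cast hn ⟨m, rfl⟩ h
  · rintro S ⟨⟨n, hn⟩, -⟩
    obtain ⟨l, hsl, heq⟩ := RootTree.exists_levels hp.one_lt s
    simp only at hn
    have hsS : s ≤ S := by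
      have := le_min (hfs n) (hgs n)
      rw [hn] at this
      exact_mod_cast this
    refine coe_le_coe_intVal fun hr => ?_
    obtain ⟨a, ha, hle⟩ := resultant_intVal_ge (p := p) (D := S - s) hf hg hfs hgs hsl n
      (by rw [Nat.add_sub_cancel' hsS, ← hn]; exact min_le_left _ _)
      (by rw [Nat.add_sub_cancel' hsS, ← hn]; exact min_le_right _ _) hr
    refine ⟨a, ha, ?_⟩
    rw [heq]
    rw [Nat.cast_sub hsS] at hle
    linarith
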